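/- All Hilbert spaces are finite-dimensional, $A=\mathbb C^{d_A}$, $B=\mathbb C^{d_B}$, $E=\mathbb C^{d_E}$, with their canonical bases; a quantum channel is a completely positive trace-preserving linear map, and a state is a positive semidefinite matrix of trace one. Let $\mathcal M$ be a quantum channel from $A$ to $B$, and let $\widehat{\mathcal M}$ be a complementary channel of $\mathcal M$, from $A$ to $E$: there is an isometry $W:A\to B\otimes E$ with $\mathcal M(\varrho)=\mathrm{Tr}_E[W\varrho W^\dagger]$ and $\widehat{\mathcal M}(\varrho)=\mathrm{Tr}_B[W\varrho W^\dagger]$ for all states $\varrho$ on $A$. The channel $\mathcal M$ is called degradable if there is a quantum channel $\mathcal D$ from $B$ to $E$ with $\mathcal D\circ\mathcal M=\widehat{\mathcal M}$ on states, and conjugate degradable if there is a quantum channel $\overline{\mathcal D}$ from $B$ to $E$ with $\overline{\mathcal D}\circ\mathcal M=\mathcal C\circ\widehat{\mathcal M}$ on states, where $\mathcal C$ is entrywise complex conjugation in the canonical basis of $E$. If $\mathcal M$ is conjugate degradable but not degradable, then $d_B>d_A$. -/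

import Mathlib

namespace QuantumChannel

open Matrix
open scoped ComplexOrder

section Definitions

variable {a b e : Type*} [Fintype a] [Fintype b] [Fintype e]

/-- A state (density matrix): a positive semidefinite matrix of trace one. -/
def IsState (ρ : Matrix a a ℂ) : Prop :=
  ρ.PosSemidef ∧ ρ.trace = 1

/-- The ampliation `Φ ⊗ id` of a linear map `Φ` by an ancilla with index set `r`:
`Φ` is applied to every block `X_{st} = (X_{(i,s),(j,t)})_{i,j}` of `X`. -/
def ampliate (Φ : Matrix a a ℂ →ₗ[ℂ] Matrix b b ℂ) (r : Type*)
    (X : Matrix (a × r) (a × r) ℂ) : Matrix (b × r) (b × r) ℂ :=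
  Matrix.of fun p q => Φ (Matrix.of fun i j => X (i, p.2) (j, q.2)) p.1 q.1

/-- Complete positivity: `Φ ⊗ id` preserves positive semidefiniteness for every
finite-dimensional ancilla. -/
def IsCompletelyPositive (Φ : Matrix a a ℂ →ₗ[ℂ] Matrix b b ℂ) : Prop :=
  ∀ (d : ℕ) (X : Matrix (a × Fin d) (a × Fin d) ℂ),
    X.PosSemidef → (ampliate Φ (Fin d) X).PosSemidef

/-- A quantum channel (Schrödinger picture): a completely positive trace-preserving map. -/
structure IsChannel (Φ : Matrix a a ℂ →ₗ[ℂ] Matrix b b ℂ) : Prop where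
  completelyPositive : IsCompletelyPositive Φ
  tracePreserving : ∀ X : Matrix a a ℂ, (Φ X).trace = X.trace

/-- Partial trace over the second tensor factor, `Tr_E : BE → B`. -/
def traceSnd (X : Matrix (b × e) (b × e) ℂ) : Matrix b b ℂ :=
  Matrix.of fun i j => ∑ k, X (i, k) (j, k)

/-- Partial trace over the first tensor factor, `Tr_B : BE → E`. -/
def traceFst (X : Matrix (b × e) (b × e) ℂ) : Matrix e e ℂ :=
  Matrix.of fun k l => ∑ i, X (i, k) (i, l)

/-- `N : A → E` is a complementary channel of `M : A → B`: there is an isometry `W : A → BE`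
(a Stinespring purification of `M`) with `M ρ = Tr_E (W ρ W†)` and `N ρ = Tr_B (W ρ W†)`. -/
def IsComplementary [DecidableEq a] (M : Matrix a a ℂ →ₗ[ℂ] Matrix b b ℂ)
    (N : Matrix a a ℂ →ₗ[ℂ] Matrix e e ℂ) : Prop :=
  ∃ W : Matrix (b × e) a ℂ, Wᴴ * W = 1 ∧
    (∀ ρ : Matrix a a ℂ, IsState ρ → M ρ = traceSnd (W * ρ * Wᴴ)) ∧
    (∀ ρ : Matrix a a ℂ, IsState ρ → N ρ = traceFst (W * ρ * Wᴴ))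

/-- Entrywise complex conjugation `C` in the canonical basis. -/
def conjugation (X : Matrix e e ℂ) : Matrix e e ℂ :=
  X.map (starRingEnd ℂ)

/-- `M`, with complementary channel `N`, is degradable: some channel `D` satisfies
`D ∘ M = N` on states. -/
def IsDegradable (M : Matrix a a ℂ →ₗ[ℂ] Matrix b b ℂ)
    (N : Matrix a a ℂ →ₗ[ℂ] Matrix e e ℂ) : Prop :=
  ∃ D : Matrix b b ℂ →ₗ[ℂ] Matrix e e ℂ, IsChannel D ∧
    ∀ ρ : Matrix a a ℂ, IsState ρ → D (M ρ) = N ρ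

/-- `M`, with complementary channel `N`, is conjugate degradable: some channel `D` satisfies
`D ∘ M = C ∘ N` on states, where `C` is entrywise complex conjugation. -/
def IsConjugateDegradable (M : Matrix a a ℂ →ₗ[ℂ] Matrix b b ℂ)
    (N : Matrix a a ℂ →ₗ[ℂ] Matrix e e ℂ) : Prop :=
  ∃ D : Matrix b b ℂ →ₗ[ℂ] Matrix e e ℂ, IsChannel D ∧
    ∀ ρ : Matrix a a ℂ, IsState ρ → D (M ρ) = conjugation (N ρ)

end Definitions

end QuantumChannel

namespace QuantumChannel

open Matrix
open scoped ComplexOrder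

/-! Let `K k` be the Kraus blocks of `W`. Conjugate degradability makes the transpose of the
complementary channel completely positive, so the block matrix Q with blocks `(K l)ᴴ * K k` is
positive semidefinite (`crossGram_posSemidef_of_isConjugateDegradable`). Positivity forces a
combination T of the `K k` of maximal rank to be injective (`injective_of_crossGram_posSemidef`).

Suppose d_B ≤ d_A. Then T is invertible, and the operators X_k = K_k T⁻¹ have a combination equal to
1. A congruence of their block matrix yields a positive matrix whose blocks are the commutators
[X_lᴴ, X_k]; its trace is zero, so it vanishes. By Fuglede the X_k are commuting normal operators,
from which a degrading channel is built explicitly (`isDegradable_of_conjTranspose_mul_comm`). -/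

theorem map_mem_range_of_finrank_range_le {V W : Type*} [AddCommGroup V] [Module ℂ V]
    [NormedAddCommGroup W] [NormedSpace ℂ W] [FiniteDimensional ℂ W] (f g : V →ₗ[ℂ] W)
    (h : ∀ t : ℂ, Module.finrank ℂ (LinearMap.range (f + t • g)) ≤
      Module.finrank ℂ (LinearMap.range f)) {v : V} (hv : f v = 0) :
    g v ∈ LinearMap.range f := by
  by_contra hgv
  set r := Module.finrank ℂ (LinearMap.range f)
  let β := Module.finBasis ℂ (LinearMap.range f)
  choose x hx using fun i => (β i).2
  -- For t ≠ 0, `g v` is the image of `t⁻¹ • v` under `f + t • g`, so all r + 1 vectors lie in its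
  -- range. Independence at t = 0 persists for small t and contradicts the rank bound.
  let u : ℂ → Fin (r + 1) → W := fun t => Fin.cons (g v) fun i => f (x i) + t • g (x i)
  have hu0 : LinearIndependent ℂ (u 0) := by
    have hβ : LinearIndependent ℂ fun i => f (x i) := by
      simp only [hx]
      exact β.linearIndependent.map' (LinearMap.range f).subtype (Submodule.ker_subtype _)
    simp only [u, zero_smul, add_zero]
    refine linearIndependent_finCons.2 ⟨hβ, fun hmem => hgv (Submodule.span_le.2 ?_ hmem)⟩
    rintro _ ⟨i, rfl⟩
    exact ⟨x i, rfl⟩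
  have hcont : Continuous u := by
    refine continuous_pi fun i => ?_
    refine Fin.cases ?_ (fun j => ?_) i
    · simpa [u] using continuous_const
    · simp only [u, Fin.cons_succ]
      fun_prop
  have hev : ∀ᶠ t in nhds (0 : ℂ), LinearIndependent ℂ (u t) :=
    hcont.continuousAt.eventually (isOpen_setOfPred_linearIndependent.mem_nhds hu0)
  obtain ⟨t, htu, ht⟩ := ((hev.filter_mono nhdsWithin_le_nhds).and
    (self_mem_nhdsWithin : ∀ᶠ t in nhdsWithin (0 : ℂ) {0}ᶜ, t ∈ ({0}ᶜ : Set ℂ))).exists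
  have hmem : ∀ i, u t i ∈ LinearMap.range (f + t • g) := by
    refine Fin.cases ⟨t⁻¹ • v, ?_⟩ fun i => ⟨x i, by simp [u]⟩
    have ht0 : t ≠ 0 := ht
    simp [u, hv, smul_smul, inv_mul_cancel₀ ht0]
  have hli : LinearIndependent ℂ
      fun i => (⟨u t i, hmem i⟩ : LinearMap.range (f + t • g)) :=
    LinearIndependent.of_comp (LinearMap.range (f + t • g)).subtype htu
  have := hli.fintype_card_le_finrank
  have := h t
  simp at *
  omega

/-! ### Kraus blocks and their cross Gram matrix -/

section

variable {a b e : Type*} [Fintype a] [Fintype b] [Fintype e]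

/-- The `k`-th Kraus operator of `ρ ↦ Tr_E (W ρ W†)`. -/
def krausBlock (W : Matrix (b × e) a ℂ) (k : e) : Matrix b a ℂ :=
  W.submatrix (fun i => (i, k)) id

/-- The block matrix whose block at `(k, l)` is `(K l)ᴴ * K k`. -/
def crossGram (K : e → Matrix b a ℂ) : Matrix (e × a) (e × a) ℂ :=
  Matrix.of fun p q => ((K q.1)ᴴ * K p.1) p.2 q.2

omit [Fintype e] in
theorem traceFst_apply_eq_trace (W : Matrix (b × e) a ℂ) (X : Matrix a a ℂ) (k l : e) :
    traceFst (W * X * Wᴴ) k l = (krausBlock W k * X * (krausBlock W l)ᴴ).trace := by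
  simp [traceFst, krausBlock, Matrix.trace, Matrix.mul_apply]

omit [Fintype b] in
theorem traceSnd_eq_sum (W : Matrix (b × e) a ℂ) (X : Matrix a a ℂ) :
    traceSnd (W * X * Wᴴ) = ∑ k, krausBlock W k * X * (krausBlock W k)ᴴ := by
  ext i j
  simp [traceSnd, krausBlock, Matrix.sum_apply, Matrix.mul_apply]

omit [Fintype a] in
theorem conjTranspose_mul_self_eq_sum (W : Matrix (b × e) a ℂ) :
    Wᴴ * W = ∑ k, (krausBlock W k)ᴴ * krausBlock W k := by
  ext i j
  simp only [krausBlock, Matrix.sum_apply, Matrix.mul_apply, Fintype.sum_prod_type,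
    conjTranspose_apply, submatrix_apply, id]
  exact Finset.sum_comm

/-- The linear map `X ↦ Tr_B (V X V†)`. -/
def traceFstConj (V : Matrix (b × e) a ℂ) : Matrix a a ℂ →ₗ[ℂ] Matrix e e ℂ where
  toFun X := traceFst (V * X * Vᴴ)
  map_add' X Y := by
    ext k l
    simp [traceFst, Matrix.mul_add, Matrix.add_mul, Finset.sum_add_distrib]
  map_smul' c X := by
    ext k l
    simp [traceFst, Finset.mul_sum]

theorem isChannel_traceFstConj [DecidableEq a] {V : Matrix (b × e) a ℂ} (hV : Vᴴ * V = 1) :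
    IsChannel (traceFstConj V) where
  completelyPositive d X hX := by
    have h : ampliate (traceFstConj V) (Fin d) X =
        ∑ i : b, (Matrix.of fun (p : e × Fin d) (q : a × Fin d) =>
          V (i, p.1) q.1 * (1 : Matrix (Fin d) (Fin d) ℂ) p.2 q.2) * X *
        (Matrix.of fun (p : e × Fin d) (q : a × Fin d) =>
          V (i, p.1) q.1 * (1 : Matrix (Fin d) (Fin d) ℂ) p.2 q.2)ᴴ := by
      ext ⟨k, s⟩ ⟨l, t⟩
      simp [ampliate, traceFstConj, traceFst, Matrix.sum_apply, Matrix.mul_apply,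
        Fintype.sum_prod_type, Matrix.one_apply, apply_ite]
    rw [h]
    exact Matrix.posSemidef_sum _ fun i _ => hX.mul_mul_conjTranspose_same _
  tracePreserving X := by
    have h : (traceFstConj V X).trace = (V * X * Vᴴ).trace := by
      simp only [traceFstConj, LinearMap.coe_mk, AddHom.coe_mk, traceFst, Matrix.trace,
        Matrix.diag, Matrix.of_apply, Fintype.sum_prod_type]
      exact Finset.sum_comm
    rw [h, Matrix.trace_mul_comm, ← Matrix.mul_assoc, hV, Matrix.one_mul]

theorem injective_of_crossGram_posSemidef {K : e → Matrix b a ℂ} (hQ : (crossGram K).PosSemidef)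
    (hK : ∀ v : a → ℂ, (∀ k, K k *ᵥ v = 0) → v = 0) :
    ∃ c : e → ℂ, Function.Injective (∑ k, c k • K k).mulVec := by
  classical
  obtain ⟨c, hc⟩ : ∃ c : e → ℂ, ∀ c' : e → ℂ,
      (∑ k, c' k • K k).rank ≤ (∑ k, c k • K k).rank := by
    have hbdd : BddAbove (Set.range fun c : e → ℂ => (∑ k, c k • K k).rank) :=
      ⟨Fintype.card a, by rintro _ ⟨c, rfl⟩; exact Matrix.rank_le_card_width _⟩
    obtain ⟨c, hc⟩ := Nat.sSup_mem (Set.range_nonempty _) hbdd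
    exact ⟨c, fun c' => (le_csSup hbdd ⟨c', rfl⟩).trans hc.ge⟩
  refine ⟨c, ?_⟩
  set T := ∑ k, c k • K k with hT
  refine (injective_iff_map_eq_zero T.mulVecLin).2 fun v hv => hK v fun k => ?_
  rw [Matrix.mulVecLin_apply] at hv
  have hperp : Tᴴ *ᵥ (K k *ᵥ v) = 0 := by
    -- The quadratic form of `crossGram K` at `w` is ‖T v‖² = 0, so positivity puts `w` in the
    -- kernel.
    let w : e × a → ℂ := fun p => star (c p.1) * v p.2
    have hw : ∀ k, (fun s => (crossGram K *ᵥ w) (k, s)) = Tᴴ *ᵥ (K k *ᵥ v) := by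
      intro k
      ext s
      simp only [hT, conjTranspose_sum, conjTranspose_smul, mulVec_mulVec, Matrix.sum_mul,
        Matrix.sum_mulVec, Matrix.smul_mul, Matrix.smul_mulVec, Finset.sum_apply, Pi.smul_apply,
        smul_eq_mul]
      simp only [mulVec, dotProduct, crossGram, Fintype.sum_prod_type, w, Matrix.of_apply,
        Finset.mul_sum]
      exact Finset.sum_congr rfl fun l _ => Finset.sum_congr rfl fun t _ => by ring
    have hzero : star w ⬝ᵥ (crossGram K *ᵥ w) = 0 := by
      have h1 : star w ⬝ᵥ (crossGram K *ᵥ w) =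
          ∑ k, c k * (star v ⬝ᵥ (Tᴴ *ᵥ (K k *ᵥ v))) := by
        simp only [← hw, dotProduct, Fintype.sum_prod_type, Finset.mul_sum]
        simp [w, mul_assoc]
      have h2 : ∑ k, c k * (star v ⬝ᵥ (Tᴴ *ᵥ (K k *ᵥ v))) = star v ⬝ᵥ (Tᴴ *ᵥ (T *ᵥ v)) := by
        conv_rhs => rw [hT, Matrix.sum_mulVec, ← hT, Matrix.mulVec_sum, dotProduct_sum]
        simp [Matrix.smul_mulVec, Matrix.mulVec_smul]
      rw [h1, h2, hv]
      simp
    have hQw := (hQ.dotProduct_mulVec_zero_iff w).1 hzero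
    rw [← hw k, hQw]
    rfl
  -- Maximality of the rank of T enters here. Since `K k *ᵥ v` is also in the kernel of `Tᴴ`, it is
  -- orthogonal to the range containing it, hence zero.
  have hrange : K k *ᵥ v ∈ LinearMap.range T.mulVecLin := by
    refine map_mem_range_of_finrank_range_le T.mulVecLin (K k).mulVecLin (fun t => ?_) hv
    have := hc (c + (Pi.single k t : e → ℂ))
    have hs : ∑ j, (c + (Pi.single k t : e → ℂ)) j • K j = T + t • K k := by
      simp [add_smul, Finset.sum_add_distrib, hT, Pi.single_apply]
    have hl : (T + t • K k).mulVecLin = T.mulVecLin + t • (K k).mulVecLin := by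
      ext1 x
      simp
    rwa [hs, Matrix.rank, Matrix.rank, hl] at this
  obtain ⟨x, hx⟩ := hrange
  rw [Matrix.mulVecLin_apply] at hx
  rw [← hx, mulVec_mulVec, conjTranspose_mul_self_mulVec_eq_zero] at hperp
  rw [← hx, hperp]

theorem exists_inverse_of_injective [DecidableEq a] [DecidableEq b] {T : Matrix b a ℂ}
    (hT : Function.Injective T.mulVec) (hcard : Fintype.card b ≤ Fintype.card a) :
    ∃ L : Matrix a b ℂ, L * T = 1 ∧ T * L = 1 := by
  have hcard' : Fintype.card a = Fintype.card b := by
    refine le_antisymm ?_ hcard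
    simpa using LinearMap.finrank_le_finrank_of_injective (f := T.mulVecLin) hT
  have hu : IsUnit (Tᴴ * T) := by
    refine Matrix.mulVec_injective_iff_isUnit.1
      ((injective_iff_map_eq_zero (Tᴴ * T).mulVecLin).2 fun v hv => hT ?_)
    rw [mulVecLin_apply, conjTranspose_mul_self_mulVec_eq_zero] at hv
    rw [hv, mulVec_zero]
  have h1 : ((Tᴴ * T)⁻¹ * Tᴴ) * T = 1 := by
    rw [Matrix.mul_assoc]
    exact Matrix.nonsing_inv_mul _ ((Matrix.isUnit_iff_isUnit_det _).1 hu)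
  exact ⟨_, h1, (mul_eq_one_comm_of_card_eq _ _ _ hcard').1 h1⟩

theorem crossGram_mul {c : Type*} [Fintype c] [DecidableEq e] (K : e → Matrix b a ℂ)
    (L : Matrix a c ℂ) : crossGram (fun k => K k * L) =
      (Matrix.of fun (p : e × c) (q : e × a) => (1 : Matrix e e ℂ) p.1 q.1 * Lᴴ p.2 q.2) *
        crossGram K *
      (Matrix.of fun (p : e × c) (q : e × a) => (1 : Matrix e e ℂ) p.1 q.1 * Lᴴ p.2 q.2)ᴴ := by
  ext ⟨k, s⟩ ⟨l, t⟩
  have : (K l * L)ᴴ * (K k * L) = Lᴴ * ((K l)ᴴ * K k) * L := by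
    simp [Matrix.mul_assoc]
  simp only [crossGram, Matrix.of_apply, this]
  simp [Matrix.mul_apply, Fintype.sum_prod_type, Matrix.one_apply, apply_ite]

/-- If some linear combination of the `X k` is the identity, positivity of `crossGram X` forces
the `X k` to be normal and to commute with each other's adjoints. -/
theorem conjTranspose_mul_comm_of_crossGram_posSemidef [DecidableEq b] {X : e → Matrix b b ℂ}
    (hX : (crossGram X).PosSemidef) {c : e → ℂ} (hc : ∑ k, c k • X k = 1) (k l : e) :
    (X l)ᴴ * X k = X k * (X l)ᴴ := by
  classical
  let Q : Matrix e e (Matrix b b ℂ) := Matrix.of fun k l => (X l)ᴴ * X k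
  -- Because `∑ c j • X j = 1`, left multiplication by `S` turns the blocks of `Q` into commutators.
  -- These vanish when summed against `star (c j)`, so right multiplication by `Sᴴ` leaves `R`
  -- unchanged and R = S Q Sᴴ.
  let S : Matrix e e (Matrix b b ℂ) := Matrix.of fun k j => (if k = j then 1 else 0) - c j • X k
  let R : Matrix e e (Matrix b b ℂ) := Matrix.of fun k l => (X l)ᴴ * X k - X k * (X l)ᴴ
  have hc' : ∑ k, star (c k) • (X k)ᴴ = 1 := by
    simpa [conjTranspose_sum] using congrArg conjTranspose hc
  have hSQ : S * Q = R := by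
    ext1 k l
    simp only [S, Q, R, Matrix.mul_apply, Matrix.of_apply, sub_mul, Finset.sum_sub_distrib,
      ite_mul, one_mul, zero_mul, Finset.sum_ite_eq, Finset.mem_univ, if_true]
    congr 1
    calc ∑ j, (c j • X k) * ((X l)ᴴ * X j) = X k * (X l)ᴴ * ∑ j, c j • X j := by
          simp [Finset.mul_sum, mul_assoc]
      _ = _ := by rw [hc, mul_one]
  have hRS : R * Sᴴ = R := by
    ext1 k l
    have hS : ∀ j, Sᴴ j l = (if l = j then 1 else 0) - star (c j) • (X l)ᴴ := by
      intro j
      simp only [S, conjTranspose_apply, Matrix.of_apply, star_sub, star_smul, apply_ite star,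
        star_one, star_zero]
      rfl
    simp only [Matrix.mul_apply, hS, mul_sub, Finset.sum_sub_distrib, mul_ite, mul_one, mul_zero,
      Finset.sum_ite_eq, Finset.mem_univ, if_true]
    rw [sub_eq_self]
    have h0 : ∑ j, star (c j) • R k j = 0 := by
      calc ∑ j, star (c j) • R k j
          = (∑ j, star (c j) • (X j)ᴴ) * X k - X k * ∑ j, star (c j) • (X j)ᴴ := by
            simp [R, Finset.mul_sum, Finset.sum_mul, smul_sub]
        _ = 0 := by rw [hc', one_mul, mul_one, sub_self]
    calc ∑ j, R k j * star (c j) • (X l)ᴴ = (∑ j, star (c j) • R k j) * (X l)ᴴ := by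
          simp [Finset.sum_mul]
      _ = 0 := by rw [h0, zero_mul]
  have hcomp : comp e e b b ℂ R = comp e e b b ℂ S * crossGram X * (comp e e b b ℂ S)ᴴ := by
    have hQ : crossGram X = compRingEquiv e b ℂ Q := rfl
    have hS : (comp e e b b ℂ S)ᴴ = compRingEquiv e b ℂ Sᴴ := rfl
    rw [hQ, hS, ← compRingEquiv_apply, ← compRingEquiv_apply, ← map_mul, ← map_mul, hSQ, hRS]
  have hpos : (comp e e b b ℂ R).PosSemidef := by
    rw [hcomp]
    exact hX.mul_mul_conjTranspose_same _
  have htr : (comp e e b b ℂ R).trace = 0 := by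
    have : (comp e e b b ℂ R).trace = ∑ k, (R k k).trace := by
      simp [Matrix.trace, Fintype.sum_prod_type]
    rw [this]
    refine Finset.sum_eq_zero fun k _ => ?_
    simp only [R, Matrix.of_apply, Matrix.trace_sub, Matrix.trace_mul_comm (X k), sub_self]
  have hR := hpos.trace_eq_zero_iff.1 htr
  refine sub_eq_zero.1 ?_
  ext i j
  exact congrFun (congrFun hR (k, i)) (l, j)

/-! ### From identities on states to positivity of the cross Gram matrix -/

theorem span_isState [DecidableEq a] :
    Submodule.span ℂ {ρ : Matrix a a ℂ | IsState ρ} = ⊤ := by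
  set P := Submodule.span ℂ {ρ : Matrix a a ℂ | IsState ρ}
  have hpos : ∀ X : Matrix a a ℂ, X.PosSemidef → X ∈ P := by
    intro X hX
    by_cases h : X.trace = 0
    · rw [hX.trace_eq_zero_iff.1 h]
      exact P.zero_mem
    · have hs : IsState (X.trace⁻¹ • X) :=
        ⟨hX.smul (inv_nonneg.2 hX.trace_nonneg), by simp [h]⟩
      have := P.smul_mem X.trace (Submodule.subset_span hs)
      rwa [smul_smul, mul_inv_cancel₀ h, one_smul] at this
  open scoped MatrixOrder Matrix.Norms.L2Operator in
  rw [eq_top_iff, ← CStarAlgebra.span_nonneg (A := Matrix a a ℂ)]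
  refine Submodule.span_le.2 fun X hX => hpos X ?_
  exact Matrix.nonneg_iff_posSemidef.1 hX

theorem eq_of_forall_isState [DecidableEq a] {V : Type*} [AddCommMonoid V] [Module ℂ V]
    {f g : Matrix a a ℂ →ₗ[ℂ] V} (h : ∀ ρ, IsState ρ → f ρ = g ρ) : f = g :=
  LinearMap.ext_on span_isState h

omit [Fintype e] in
theorem IsState.conjugation_traceFst {W : Matrix (b × e) a ℂ} {ρ : Matrix a a ℂ}
    (hρ : IsState ρ) :
    conjugation (traceFst (W * ρ * Wᴴ)) = (traceFst (W * ρ * Wᴴ))ᵀ := by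
  have h : (W * ρ * Wᴴ)ᴴ = W * ρ * Wᴴ := isHermitian_mul_mul_conjTranspose W hρ.1.1
  ext k l
  simp only [conjugation, traceFst, Matrix.map_apply, Matrix.of_apply, transpose_apply, map_sum]
  exact Finset.sum_congr rfl fun i _ => congrFun (congrFun h (i, l)) (i, k)

/-- A conjugate degradable channel has a complementary channel with positive partial transpose. -/
theorem crossGram_posSemidef_of_isConjugateDegradable {n : ℕ}
    {M : Matrix (Fin n) (Fin n) ℂ →ₗ[ℂ] Matrix b b ℂ}
    {N : Matrix (Fin n) (Fin n) ℂ →ₗ[ℂ] Matrix e e ℂ} (hM : IsChannel M)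
    {W : Matrix (b × e) (Fin n) ℂ}
    (hN : ∀ ρ : Matrix (Fin n) (Fin n) ℂ, IsState ρ → N ρ = traceFst (W * ρ * Wᴴ))
    (hconj : IsConjugateDegradable M N) : (crossGram (krausBlock W)).PosSemidef := by
  obtain ⟨D, hD, hDM⟩ := hconj
  -- Conjugation is antilinear, but on Hermitian outputs it agrees with the transpose, which is
  -- linear and so extends from states to all matrices.
  have hlin : D ∘ₗ M = (transposeLinearEquiv e e ℂ ℂ).toLinearMap ∘ₗ traceFstConj W := by
    refine eq_of_forall_isState fun ρ hρ => ?_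
    rw [LinearMap.comp_apply, hDM ρ hρ, hN ρ hρ, hρ.conjugation_traceFst]
    rfl
  -- The unnormalised maximally entangled vector: its image under the ampliations is the Choi matrix
  -- of `D ∘ₗ M`.
  let ω : Fin n × Fin n → ℂ := fun p => (1 : Matrix (Fin n) (Fin n) ℂ) p.1 p.2
  have hpos := hD.completelyPositive n _
    (hM.completelyPositive n _ (posSemidef_vecMulVec_self_star ω))
  have hC : ampliate D (Fin n) (ampliate M (Fin n) (vecMulVec ω (star ω))) =
      (crossGram (krausBlock W))ᵀ := by
    ext ⟨k, s⟩ ⟨l, t⟩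
    have h1 : (Matrix.of fun i j => vecMulVec ω (star ω) (i, s) (j, t)) =
        Matrix.single s t (1 : ℂ) := by
      ext i j
      simp [vecMulVec_apply, ω, Matrix.one_apply, Matrix.single_apply, eq_comm, ← ite_and, and_comm]
    have h2 : ampliate D (Fin n) (ampliate M (Fin n) (vecMulVec ω (star ω))) (k, s) (l, t) =
        (D ∘ₗ M) (Matrix.single s t (1 : ℂ)) k l := by
      rw [← h1]
      rfl
    rw [h2, hlin]
    change traceFst (W * Matrix.single s t 1 * Wᴴ) l k = _
    rw [traceFst_apply_eq_trace, Matrix.trace_mul_comm, ← Matrix.mul_assoc, Matrix.trace_mul_single]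
    simp [crossGram]
  rw [hC] at hpos
  simpa using hpos.transpose

/-! ### The degrading channel -/

omit [Fintype e] in
open scoped Matrix.Norms.L2Operator in
theorem commute_of_conjTranspose_mul_comm [DecidableEq b] {X : e → Matrix b b ℂ}
    (h : ∀ k l, (X l)ᴴ * X k = X k * (X l)ᴴ) (k l : e) : Commute (X k) (X l) := by
  have hn : IsStarNormal (star (X l)) := ⟨by
    rw [star_star]
    exact (h l l).symm⟩
  -- Fuglede's theorem for the normal operator `star (X l)`.
  have := hn.commute_star_right (x := X k) (h k l).symm
  rwa [star_star] at this

/-- The inverse G = T Tᴴ of S = ∑ X_jᴴ X_j commutes with every X_k. Hence the blocks Tᴴ X_k form an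
isometry from B to A ⊗ E, and tracing out A degrades `M`: commutation collapses ∑_j X_jᴴ X_lᴴ G X_k
X_j to X_lᴴ X_k, which gives the (k, l) entry of `N ρ`. -/
theorem isDegradable_of_conjTranspose_mul_comm [DecidableEq a] [DecidableEq b]
    {M : Matrix a a ℂ →ₗ[ℂ] Matrix b b ℂ} {N : Matrix a a ℂ →ₗ[ℂ] Matrix e e ℂ}
    {W : Matrix (b × e) a ℂ} (hW : Wᴴ * W = 1)
    (hM : ∀ ρ : Matrix a a ℂ, IsState ρ → M ρ = traceSnd (W * ρ * Wᴴ))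
    (hN : ∀ ρ : Matrix a a ℂ, IsState ρ → N ρ = traceFst (W * ρ * Wᴴ))
    {T : Matrix b a ℂ} {L : Matrix a b ℂ} (hLT : L * T = 1) (hTL : T * L = 1)
    (hX : ∀ k l, (krausBlock W l * L)ᴴ * (krausBlock W k * L) =
      krausBlock W k * L * (krausBlock W l * L)ᴴ) : IsDegradable M N := by
  obtain ⟨X, hXdef⟩ : ∃ X : e → Matrix b b ℂ, ∀ k, X k = krausBlock W k * L := ⟨_, fun _ => rfl⟩
  simp only [← hXdef] at hX
  have hXc := commute_of_conjTranspose_mul_comm hX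
  have hK : ∀ k, krausBlock W k = X k * T := fun k => by
    rw [hXdef, Matrix.mul_assoc, hLT, Matrix.mul_one]
  let S := ∑ j, (X j)ᴴ * X j
  let G := T * Tᴴ
  have hS : S = Lᴴ * L := by
    calc S = Lᴴ * (∑ k, (krausBlock W k)ᴴ * krausBlock W k) * L := by
          simp [S, hXdef, Matrix.mul_sum, Matrix.sum_mul, Matrix.mul_assoc]
      _ = Lᴴ * L := by rw [← conjTranspose_mul_self_eq_sum, hW, Matrix.mul_one]
  have hSG : S * G = 1 := by
    calc S * G = Lᴴ * (L * T) * Tᴴ := by simp [hS, G, Matrix.mul_assoc]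
      _ = (T * L)ᴴ := by rw [hLT, Matrix.mul_one, conjTranspose_mul]
      _ = 1 := by rw [hTL, conjTranspose_one]
  have hGS : G * S = 1 := mul_eq_one_comm.1 hSG
  have hXS : ∀ k, Commute (X k) S := fun k =>
    Commute.sum_right _ _ _ fun j _ => Commute.mul_right (hX k j).symm (hXc k j)
  have hXG : ∀ k, G * X k = X k * G := fun k => by
    calc G * X k = G * (X k * S) * G := by rw [mul_assoc, mul_assoc, hSG, mul_one]
      _ = G * S * X k * G := by rw [(hXS k).eq, mul_assoc G S]
      _ = X k * G := by rw [hGS, one_mul]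
  let V : Matrix (a × e) b ℂ := Matrix.of fun p j => (Tᴴ * X p.2) p.1 j
  have hV : ∀ k, krausBlock V k = Tᴴ * X k := fun k => rfl
  have hVV : Vᴴ * V = 1 := by
    rw [conjTranspose_mul_self_eq_sum]
    calc ∑ k, (krausBlock V k)ᴴ * krausBlock V k = ∑ k, (X k)ᴴ * (G * X k) := by
          simp [hV, G, Matrix.mul_assoc]
      _ = S * G := by simp [hXG, S, Matrix.sum_mul, Matrix.mul_assoc]
      _ = 1 := hSG
  refine ⟨traceFstConj V, isChannel_traceFstConj hVV, fun ρ hρ => ?_⟩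
  rw [hM ρ hρ, hN ρ hρ]
  ext k l
  change traceFst (V * _ * Vᴴ) k l = _
  rw [traceFst_apply_eq_trace, traceFst_apply_eq_trace, traceSnd_eq_sum, hV, hV, hK k, hK l]
  have hterm : ∀ j, (X j)ᴴ * ((X l)ᴴ * (G * (X k * X j))) = (X l)ᴴ * X k * ((X j)ᴴ * X j) * G := by
    intro j
    have h1 : (X j)ᴴ * (X l)ᴴ = (X l)ᴴ * (X j)ᴴ := by
      rw [← conjTranspose_mul, ← conjTranspose_mul, (hXc l j).eq]
    calc (X j)ᴴ * ((X l)ᴴ * (G * (X k * X j)))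
        = (X j)ᴴ * (X l)ᴴ * (G * X k) * X j := by simp only [mul_assoc]
      _ = (X l)ᴴ * ((X j)ᴴ * X k) * (G * X j) := by rw [h1, hXG]; simp only [mul_assoc]
      _ = (X l)ᴴ * X k * ((X j)ᴴ * X j) * G := by rw [hX k j, hXG]; simp only [mul_assoc]
  have hsum : ∑ j, (X j)ᴴ * ((X l)ᴴ * (G * (X k * X j))) = (X l)ᴴ * X k := by
    rw [Finset.sum_congr rfl fun j _ => hterm j, ← Finset.sum_mul, ← Finset.mul_sum, mul_assoc,
      hSG, mul_one]
  calc (Tᴴ * X k * (∑ j, krausBlock W j * ρ * (krausBlock W j)ᴴ) * (Tᴴ * X l)ᴴ).trace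
      = ∑ j, (Tᴴ * X k * (X j * T * ρ * (X j * T)ᴴ) * (Tᴴ * X l)ᴴ).trace := by
        simp only [hK, Matrix.mul_sum, Matrix.sum_mul, Matrix.trace_sum]
    _ = ∑ j, (T * ρ * Tᴴ * ((X j)ᴴ * ((X l)ᴴ * (G * (X k * X j))))).trace := by
        refine Finset.sum_congr rfl fun j _ => ?_
        calc (Tᴴ * X k * (X j * T * ρ * (X j * T)ᴴ) * (Tᴴ * X l)ᴴ).trace
            = (Tᴴ * X k * X j * (T * ρ * Tᴴ * (X j)ᴴ * (X l)ᴴ * T)).trace := by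
              simp only [conjTranspose_mul, conjTranspose_conjTranspose, Matrix.mul_assoc]
          _ = _ := by
              rw [Matrix.trace_mul_comm]
              simp only [G, Matrix.mul_assoc]
    _ = (T * ρ * Tᴴ * ((X l)ᴴ * X k)).trace := by
        rw [← Matrix.trace_sum, ← Matrix.mul_sum, hsum]
    _ = (X k * T * ρ * (X l * T)ᴴ).trace := by
        rw [← Matrix.mul_assoc, Matrix.trace_mul_comm]
        simp only [conjTranspose_mul, Matrix.mul_assoc]

theorem isDegradable_of_card_le [DecidableEq a] [DecidableEq b] [DecidableEq e]
    {M : Matrix a a ℂ →ₗ[ℂ] Matrix b b ℂ} {N : Matrix a a ℂ →ₗ[ℂ] Matrix e e ℂ}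
    {W : Matrix (b × e) a ℂ} (hW : Wᴴ * W = 1)
    (hM : ∀ ρ : Matrix a a ℂ, IsState ρ → M ρ = traceSnd (W * ρ * Wᴴ))
    (hN : ∀ ρ : Matrix a a ℂ, IsState ρ → N ρ = traceFst (W * ρ * Wᴴ))
    (hQ : (crossGram (krausBlock W)).PosSemidef) (hcard : Fintype.card b ≤ Fintype.card a) :
    IsDegradable M N := by
  obtain ⟨c, hc⟩ := injective_of_crossGram_posSemidef hQ fun v hv => by
    rw [← one_mulVec v, ← hW, conjTranspose_mul_self_eq_sum, Matrix.sum_mulVec]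
    exact Finset.sum_eq_zero fun k _ => by rw [← mulVec_mulVec, hv k, mulVec_zero]
  obtain ⟨L, hLT, hTL⟩ := exists_inverse_of_injective hc hcard
  refine isDegradable_of_conjTranspose_mul_comm hW hM hN hLT hTL
    (conjTranspose_mul_comm_of_crossGram_posSemidef (c := c) ?_ ?_)
  · rw [crossGram_mul]
    exact hQ.mul_mul_conjTranspose_same _
  · simpa [Matrix.sum_mul] using hTL

end

end QuantumChannel

theorem mainTheorem4 (dA dB dE : ℕ)
    (M : Matrix (Fin dA) (Fin dA) ℂ →ₗ[ℂ] Matrix (Fin dB) (Fin dB) ℂ)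
    (N : Matrix (Fin dA) (Fin dA) ℂ →ₗ[ℂ] Matrix (Fin dE) (Fin dE) ℂ)
    (hM : QuantumChannel.IsChannel M)
    (hN : QuantumChannel.IsComplementary M N)
    (hconj : QuantumChannel.IsConjugateDegradable M N)
    (hnot : ¬ QuantumChannel.IsDegradable M N) :
    dA < dB := by
  by_contra hlt
  obtain ⟨W, hW, hMW, hNW⟩ := hN
  refine hnot (QuantumChannel.isDegradable_of_card_le hW hMW hNW
    (QuantumChannel.crossGram_posSemidef_of_isConjugateDegradable hM hNW hconj) ?_)
  simpa using hlt
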